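/- Conventions. A closed filtration of dimension $m$ on a space $X$ is a chain $X = X_m \supseteq X_{m-1} \supseteq \dots \supseteq X_0 \supseteq X_{-1} = \emptyset$ of closed subsets (with $X_i = X$ for $i\ge m$ and $X_i=\emptyset$ for $i<0$). An $m$-dimensional topologically stratified space is defined inductively: for $m=-1$ it is the empty space, for $m=0$ a countable discrete space, and for $m>0$ a paracompact Hausdorff space $X$ with a closed filtration of dimension $m$ such that each $x \in X_j - X_{j-1}$ has a neighborhood $N$, a compact $(m-j-1)$-dimensional topologically stratified space $L$ (a link) and a homeomorphism $N \cong \mathbb{R}^j \times C(L)$, $C(L)$ being the open cone ($C(\emptyset)=\mathrm{pt}$), which takes $N \cap X_{j+i+1}$ onto $\mathbb{R}^j \times C(L_i)$ for $0\le i\le m-j-1$ and $N\cap X_j$ onto $\mathbb{R}^j \times \{\text{vertex}\}$. It is an $m$-dimensional stratified pseudomanifold if moreover $X_{m-1} = X_{m-2}$ and $X - X_{m-1}$ is dense in $X$. An $n$-dimensional stratified pseudomanifold with boundary is a pair $(X,\partial X)$, with $\partial X$ a closed subspace of the topological space $X$, together with a closed filtration $\{X_i\}$ of dimension $n$ on $X$,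 such that (1) $X-\partial X$ with the filtration $(X-\partial X)\cap X_i$ is an $n$-dimensional stratified pseudomanifold, (2) $\partial X$ with the filtration $(\partial X)_{i-1} = \partial X\cap X_i$ is an $(n-1)$-dimensional stratified pseudomanifold, and (3) $\partial X$ has an open filtered collar in $X$: there are an open neighborhood $N$ of $\partial X$ and a homeomorphism $N \to [0,1)\times \partial X$ which takes $N\cap X_i$ onto $[0,1)\times(\partial X\cap X_i)$ for all $i$ and $b$ to $(0,b)$ for all $b\in\partial X$. A rational homology $m$-manifold (without boundary) is a space $Y$ that admits the structure of an $m$-dimensional stratified pseudomanifold and satisfies, for every $y\in Y$, $H_k(Y, Y-\{y\};\mathbb{Q})\cong\mathbb{Q}$ if $k=m$ and $H_k(Y, Y-\{y\};\mathbb{Q})=0$ if $k\ne m$ (singular homology). A rational homology $n$-manifold with boundary is a pair $(X,\partial X)$ that admits the structure of an $n$-dimensional stratified pseudomanifold with boundary such that $X-\partial X$ is a rational homology $n$-manifold. Proposition. Let $n\ge 0$. If $(X,\partial X)$ is a rational homology $n$-manifold with boundary, then $\partial X$ is a rational homology $(n-1)$-manifold (without boundary). -/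

import Mathlib

open CategoryTheory AlgebraicTopology
open scoped Topology

universe u

noncomputable section

/-! ### Open cones -/

/-- The relation collapsing `L × {0}` to the vertex. -/
inductive OpenCone.Rel (L : Type u) : Unit ⊕ (L × Set.Ico (0 : ℝ) 1) →
    Unit ⊕ (L × Set.Ico (0 : ℝ) 1) → Prop
  | collapse (l : L) (t : Set.Ico (0 : ℝ) 1) (ht : (t : ℝ) = 0) :
      OpenCone.Rel L (Sum.inl ()) (Sum.inr (l, t))

/-- The open cone on `L`, i.e. `L × [0,1)` with `L × {0}` collapsed to a point.
The vertex is adjoined explicitly, so that the open cone on the empty space is a point. -/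
def OpenCone (L : Type u) : Type u := Quot (OpenCone.Rel L)

instance OpenCone.instTopologicalSpace (L : Type u) [TopologicalSpace L] :
    TopologicalSpace (OpenCone L) :=
  inferInstanceAs (TopologicalSpace (Quot (OpenCone.Rel L)))

/-- The vertex of the open cone. -/
def OpenCone.vertex (L : Type u) : OpenCone L := Quot.mk _ (Sum.inl ())

/-- The point of the open cone with coordinates `(l, t)`. -/
def OpenCone.mk {L : Type u} (l : L) (t : Set.Ico (0 : ℝ) 1) : OpenCone L :=
  Quot.mk _ (Sum.inr (l, t))

/-- The open cone on a subset `S` of `L`, as a subset of the open cone on `L`. -/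
def OpenCone.sub {L : Type u} (S : Set L) : Set (OpenCone L) :=
  {p | p = OpenCone.vertex L ∨ ∃ l ∈ S, ∃ t, p = OpenCone.mk l t}

/-! ### Stratified pseudomanifolds -/

/-- A filtration `X = X_m ⊇ X_{m-1} ⊇ ⋯ ⊇ X_0 ⊇ X_{-1} = ∅` by closed subsets, indexed by all
integers with the convention `X_i = X` for `i ≥ m` and `X_i = ∅` for `i < 0`. -/
structure IsClosedFiltration (m : ℤ) {X : Type u} [TopologicalSpace X] (F : ℤ → Set X) :
    Prop where
  isClosed : ∀ i, IsClosed (F i)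
  mono : Monotone F
  eq_univ : ∀ i, m ≤ i → F i = Set.univ
  eq_empty : ∀ i, i < 0 → F i = ∅

/-- `X` with the filtration `F` is an `m`-dimensional topologically stratified space.
The `(-1)`-dimensional ones are empty (they occur as links of points of the top stratum),
the `0`-dimensional ones are countable discrete. For `m > 0`, `X` is paracompact Hausdorff and every
point of `X_j - X_{j-1}` has a neighbourhood that is filtered homeomorphic to `ℝ^j × C(L)`
with `L` a compact `(m-j-1)`-dimensional topologically stratified space. -/
def IsTopologicallyStratified (m : ℤ) (X : Type u) [TopologicalSpace X] (F : ℤ → Set X) : Prop :=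
  IsClosedFiltration m F ∧
  ((m = -1 ∧ IsEmpty X) ∨
   (m = 0 ∧ Countable X ∧ DiscreteTopology X) ∨
   (∃ _ : 0 < m, ParacompactSpace X ∧ T2Space X ∧
    ∀ j : ℕ, ∀ x ∈ F j \ F (j - 1),
      ∃ (L : Type u) (_ : TopologicalSpace L) (G : ℤ → Set L),
        CompactSpace L ∧ IsTopologicallyStratified (m - j - 1) L G ∧
        ∃ N ∈ 𝓝 x, ∃ φ : N ≃ₜ EuclideanSpace ℝ (Fin j) × OpenCone L,
          (∀ i : ℤ, 0 ≤ i → i ≤ m - j - 1 →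
            ∀ y : N, (y : X) ∈ F (j + i + 1) ↔ (φ y).2 ∈ OpenCone.sub (G i)) ∧
          (∀ y : N, (y : X) ∈ F j ↔ (φ y).2 = OpenCone.vertex L)))
termination_by (m + 1).toNat
decreasing_by omega

/-- `X` with the filtration `F` is an `m`-dimensional stratified pseudomanifold
(without boundary): a topologically stratified space with `X_{m-1} = X_{m-2}` and
`X - X_{m-1}` dense in `X`. -/
structure IsStratifiedPseudomanifold (m : ℤ) (X : Type u) [TopologicalSpace X]
    (F : ℤ → Set X) : Prop where
  stratified : IsTopologicallyStratified m X F
  codim_one : F (m - 1) = F (m - 2)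
  dense : Dense (F (m - 1))ᶜ

/-- `(X, B)` with the filtration `F` of `X` is an `n`-dimensional stratified pseudomanifold with
boundary `B`: the interior `X - B` with `(X - B)_i = (X - B) ∩ X_i` and the boundary `B` with
`B_{i-1} = B ∩ X_i` are stratified pseudomanifolds of dimension `n` and `n - 1`, and `B` has an open
filtered collar `N ≅ [0,1) × B`, where `([0,1) × B)_i = [0,1) × B_{i-1}`. -/
structure IsStratifiedPseudomanifoldWithBoundary (n : ℤ) {X : Type u} [TopologicalSpace X]
    (B : Set X) (F : ℤ → Set X) : Prop where
  isClosed : IsClosed B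
  filtration : IsClosedFiltration n F
  interior : IsStratifiedPseudomanifold n ↥(Bᶜ) (fun i => {x | (x : X) ∈ F i})
  boundary : IsStratifiedPseudomanifold (n - 1) ↥B (fun i => {x | (x : X) ∈ F (i + 1)})
  collar : ∃ N : Set X, IsOpen N ∧ ∃ hBN : B ⊆ N, ∃ φ : N ≃ₜ Set.Ico (0 : ℝ) 1 × B,
    (∀ (i : ℤ) (y : N), (y : X) ∈ F i ↔ ((φ y).2 : X) ∈ F i) ∧
    ∀ b : B, φ ⟨b, hBN b.2⟩ = (⟨0, by norm_num⟩, b)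

/-! ### Relative singular homology and rational homology manifolds -/

/-- The rational singular chain complex of a space. -/
def rationalSingularChains : TopCat.{u} ⥤ ChainComplex (ModuleCat.{u} ℚ) ℕ :=
  (singularChainComplexFunctor (ModuleCat.{u} ℚ)).obj (ModuleCat.of ℚ (ULift.{u} ℚ))

/-- The relative singular homology `H_k(X, A; ℚ)`: the homology of the quotient complex
`S(X; ℚ) / S(A; ℚ)`. -/
def relativeRationalHomology (X : Type u) [TopologicalSpace X] (A : Set X) (k : ℕ) :
    ModuleCat.{u} ℚ :=
  (Limits.cokernel (rationalSingularChains.map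
    (TopCat.ofHom (⟨Subtype.val, continuous_subtype_val⟩ : C(A, X))))).homology k

/-- `X` is a rational homology `m`-manifold (without boundary): an `m`-dimensional topological
pseudomanifold with `H_k(X, X - x; ℚ) ≅ ℚ` for `k = m` and `H_k(X, X - x; ℚ) = 0` for `k ≠ m`,
for all points `x`. -/
structure IsRationalHomologyManifold (m : ℤ) (X : Type u) [TopologicalSpace X] : Prop where
  pseudomanifold : ∃ F : ℤ → Set X, IsStratifiedPseudomanifold m X F
  localHomology_eq : ∀ (x : X) (k : ℕ), (k : ℤ) = m →
    Nonempty (relativeRationalHomology X {x}ᶜ k ≃ₗ[ℚ] ℚ)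
  localHomology_ne : ∀ (x : X) (k : ℕ), (k : ℤ) ≠ m →
    Subsingleton (relativeRationalHomology X {x}ᶜ k)

/-- `(X, B)` is a rational homology `n`-manifold with boundary `B`. -/
def IsRationalHomologyManifoldWithBoundary (n : ℤ) (X : Type u) [TopologicalSpace X]
    (B : Set X) : Prop :=
  (∃ F : ℤ → Set X, IsStratifiedPseudomanifoldWithBoundary n B F) ∧
    IsRationalHomologyManifold n ↥(Bᶜ)

end

/-! The pseudomanifold structure on `B` is part of the hypothesis, so only its local homology is at
stake. Removing the zero level of the collar embeds `(0,1) × B` as an open subset of the complement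
of `B` (`exists_isOpenEmbedding`). By excision (`nonempty_localHomology_iso`) the local homology of
the interior at the image of `(1/2, b)` is that of the product. The proof then shows `H_{k+1}((0,1)
× B, (0,1) × B - (1/2, b)) ≅ H_k(B, B - b)`, and the condition in dimension `n` becomes the
condition in dimension `n - 1`.

For this shift (`nonempty_localHomology_product_iso`), cover the punctured product `P` by two open
sets: `upper`, with the part of the fibre over `b` at or below height 1/2 removed, and `lower`, with
the part at or above it removed. Both deform to a copy of `B`, and so does the whole product, hence
`H_*((0,1) × B, upper) = 0`. The triple then gives `H_{k+1}((0,1) × B, P) ≅ H_k(P, upper)`. Excision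
turns the right side into `H_k(lower, middle)`, where `middle = (0,1) × (B - b)`, and projection to
`B` identifies this with `H_k(B, B - b)`.

Excision itself (`quasiIso_excision`) is proved from barycentric subdivision. The formulas and the
mesh estimate are established for affine chains and carried to singular chains by naturality. The
outcome, `exists_add_dSing_mem_smallChains`, is transported to Mathlib's singular complex through
the bijection `toChains`. -/

noncomputable section

/-! ### Affine simplices in a standard simplex -/

namespace AffineChain

variable {ι κ μ : Type} [Fintype ι] [Fintype κ] [Fintype μ]

/-- The affine map between standard simplices with prescribed values at the vertices. -/
def comb (v : ι → stdSimplex ℝ κ) (t : stdSimplex ℝ ι) : stdSimplex ℝ κ :=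
  ⟨∑ i, t i • (v i : κ → ℝ),
    (convex_stdSimplex ℝ κ).sum_mem (fun i _ => t.2.1 i) t.2.2 fun i _ => (v i).2⟩

lemma coe_comb (v : ι → stdSimplex ℝ κ) (t : stdSimplex ℝ ι) :
    (comb v t : κ → ℝ) = ∑ i, t i • (v i : κ → ℝ) := rfl

lemma comb_apply (v : ι → stdSimplex ℝ κ) (t : stdSimplex ℝ ι) (j : κ) :
    comb v t j = ∑ i, t i * v i j := by
  rw [coe_comb, Finset.sum_apply]
  rfl

lemma continuous_comb (v : ι → stdSimplex ℝ κ) : Continuous (comb v) := by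
  refine Continuous.subtype_mk (continuous_finsetSum _ fun i _ => ?_) _
  exact ((continuous_apply i).comp continuous_subtype_val).smul continuous_const

lemma comb_comb (w : κ → stdSimplex ℝ μ) (v : ι → stdSimplex ℝ κ) (t : stdSimplex ℝ ι) :
    comb w (comb v t) = comb (comb w ∘ v) t := by
  ext j
  simp only [comb_apply, Function.comp_apply, Finset.sum_mul, Finset.mul_sum]
  rw [Finset.sum_comm]
  simp only [mul_assoc]

lemma comb_vertex [DecidableEq ι] (v : ι → stdSimplex ℝ κ) (i : ι) :
    comb v (stdSimplex.vertex i) = v i := by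
  ext j
  rw [comb_apply, Finset.sum_eq_single i]
  · simp [DFunLike.coe]
  · intro b _ hb
    simp [DFunLike.coe, hb]
  · simp

lemma comb_vertices [DecidableEq ι] (t : stdSimplex ℝ ι) :
    comb (fun i => stdSimplex.vertex i) t = t := by
  ext j
  rw [comb_apply, Finset.sum_eq_single j]
  · simp [DFunLike.coe]
  · intro b _ hb
    simp [DFunLike.coe, hb.symm]
  · simp

lemma map_eq_comb [DecidableEq κ] (f : ι → κ) (t : stdSimplex ℝ ι) :
    stdSimplex.map f t = comb (fun i => stdSimplex.vertex (f i)) t := by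
  ext j
  rw [comb_apply]
  rw [stdSimplex.map_coe, FunOnFinite.linearMap_apply_apply, Finset.sum_filter]
  refine Finset.sum_congr rfl fun i _ => ?_
  by_cases h : f i = j
  · simp [DFunLike.coe, h]
  · simp [DFunLike.coe, h, Ne.symm h]

lemma comb_comp_subset (v : κ → stdSimplex ℝ μ) (f : ι → κ) :
    Set.range (comb (v ∘ f)) ⊆ Set.range (comb v) := by
  classical
  rintro _ ⟨t, rfl⟩
  refine ⟨stdSimplex.map f t, ?_⟩
  rw [map_eq_comb, comb_comb]
  congr 1
  ext1 i
  simp [comb_vertex]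

lemma dist_comb_le (v : ι → stdSimplex ℝ κ) (t : stdSimplex ℝ ι) (x : stdSimplex ℝ κ) {D : ℝ}
    (h : ∀ i, dist (v i) x ≤ D) : dist (comb v t) x ≤ D := by
  have := (convex_closedBall (x : κ → ℝ) D).sum_mem (t := Finset.univ) (w := fun i => t i)
    (z := fun i => (v i : κ → ℝ)) (fun i _ => t.2.1 i) t.2.2 fun i _ => h i
  exact this

/-- The barycenter of a nonempty tuple. -/
def bary {k : ℕ} (v : Fin (k + 1) → stdSimplex ℝ κ) : stdSimplex ℝ κ :=
  comb v stdSimplex.barycenter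

lemma comb_bary {k : ℕ} (w : κ → stdSimplex ℝ μ) (v : Fin (k + 1) → stdSimplex ℝ κ) :
    comb w (bary v) = bary (comb w ∘ v) := comb_comb _ _ _

/-- The vector from `v j` to the barycenter is the average of the `k + 1` vectors `v i - v j`, one
of which vanishes; this is the source of the factor `k / (k + 1)`. -/
lemma dist_bary_le {k : ℕ} (v : Fin (k + 1) → stdSimplex ℝ κ) {D : ℝ}
    (h : ∀ i j, dist (v i) (v j) ≤ D) (j : Fin (k + 1)) :
    dist (bary v) (v j) ≤ (k / (k + 1) : ℝ) * D := by
  have hk : (0 : ℝ) < k + 1 := by positivity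
  have e : (bary v).1 - (v j).1 = ∑ i ∈ Finset.univ.erase j,
      ((k + 1 : ℝ)⁻¹ • ((v i).1 - (v j).1)) := by
    rw [Finset.sum_erase _ (by simp)]
    have : (bary v).1 = ∑ i, (k + 1 : ℝ)⁻¹ • (v i).1 := by
      refine (coe_comb _ _).trans (Finset.sum_congr rfl fun i _ => ?_)
      have hb : (stdSimplex.barycenter : stdSimplex ℝ (Fin (k + 1))) i = (k + 1 : ℝ)⁻¹ := by
        exact (stdSimplex.barycenter_apply (𝕜 := ℝ) i).trans (by simp)
      rw [hb]
      rfl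
    rw [this]
    simp only [smul_sub, Finset.sum_sub_distrib, Finset.sum_const, Finset.card_univ,
      Fintype.card_fin, ← Nat.cast_smul_eq_nsmul ℝ, smul_smul]
    push_cast
    rw [mul_inv_cancel₀ hk.ne', one_smul]
  rw [Subtype.dist_eq, dist_eq_norm, e]
  refine (norm_sum_le _ _).trans ?_
  refine (Finset.sum_le_card_nsmul _ _ ((k + 1 : ℝ)⁻¹ * D) fun i _ => ?_).trans ?_
  · rw [norm_smul, Real.norm_of_nonneg (by positivity)]
    gcongr
    rw [← dist_eq_norm]
    exact h i j
  · rw [Finset.card_erase_of_mem (Finset.mem_univ _)]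
    simp [nsmul_eq_mul]
    apply le_of_eq
    ring

/-! ### Affine chains and their subdivision -/

/-- Formal combinations of `k`-tuples of points of a standard simplex. -/
abbrev Chains (κ : Type) [Fintype κ] (k : ℕ) : Type := (Fin k → stdSimplex ℝ κ) →₀ ℚ

/-- The boundary of affine chains. -/
def d (κ : Type) [Fintype κ] (k : ℕ) : Chains κ (k + 1) →ₗ[ℚ] Chains κ k :=
  ∑ i : Fin (k + 1), (-1 : ℚ) ^ (i : ℕ) • Finsupp.lmapDomain ℚ ℚ (fun v => v ∘ i.succAbove)

/-- The cone with a given apex. -/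
def cone {k : ℕ} (b : stdSimplex ℝ κ) : Chains κ k →ₗ[ℚ] Chains κ (k + 1) :=
  Finsupp.lmapDomain ℚ ℚ (fun v => Fin.cons b v)

lemma d_single {k : ℕ} (v : Fin (k + 1) → stdSimplex ℝ κ) :
    d κ k (Finsupp.single v 1) =
      ∑ i : Fin (k + 1), (-1 : ℚ) ^ (i : ℕ) • Finsupp.single (v ∘ i.succAbove) 1 := by
  simp [d, LinearMap.sum_apply, Finsupp.lmapDomain_apply, Finsupp.mapDomain_single]

lemma cone_single {k : ℕ} (b : stdSimplex ℝ κ) (v : Fin k → stdSimplex ℝ κ) :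
    cone b (Finsupp.single v 1) = Finsupp.single (Fin.cons b v : Fin (k + 1) → _) 1 := by
  simp [cone, Finsupp.mapDomain_single]

/-- Deleting the apex returns `c`; every other face is the cone on a face of `c`, with its sign
flipped by the index shift. -/
lemma d_cone {k : ℕ} (b : stdSimplex ℝ κ) (c : Chains κ (k + 1)) :
    d κ (k + 1) (cone b c) = c - cone b (d κ k c) := by
  suffices (d κ (k + 1)) ∘ₗ cone b = LinearMap.id - cone b ∘ₗ d κ k from
    LinearMap.congr_fun this c
  ext1 v
  ext1
  simp only [LinearMap.comp_apply, Finsupp.lsingle_apply, LinearMap.sub_apply, LinearMap.id_apply,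
    cone_single, d_single, map_sum, map_smul]
  rw [Fin.sum_univ_succ, sub_eq_add_neg, ← Finset.sum_neg_distrib]
  congr 1
  · simp only [Fin.val_zero, pow_zero, one_smul]
    rfl
  · refine Finset.sum_congr rfl fun i _ => ?_
    rw [Fin.val_succ, pow_succ, mul_neg_one, neg_smul]
    congr 3
    ext1 j
    refine Fin.cases ?_ (fun j => ?_) j
    · simp
    · simp

/-- Chains are indexed by number of vertices, so degree `0` is spanned by the empty tuple and the
complex is augmented; there the correction term of `d_cone` is absent. -/
lemma d_cone_zero (b : stdSimplex ℝ κ) (c : Chains κ 0) : d κ 0 (cone b c) = c := by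
  suffices (d κ 0) ∘ₗ cone b = LinearMap.id from LinearMap.congr_fun this c
  ext1 v
  ext1
  simp only [LinearMap.comp_apply, Finsupp.lsingle_apply, LinearMap.id_apply,
    cone_single, d_single]
  rw [Fin.sum_univ_succ]
  simp

/-- Every nonempty tuple is a cone on its tail, so `d_cone` reduces the claim to one degree lower
and no double sum over faces is needed. -/
lemma d_d (k : ℕ) (c : Chains κ (k + 2)) : d κ k (d κ (k + 1) c) = 0 := by
  induction k with
  | zero =>
    suffices d κ 0 ∘ₗ d κ 1 = 0 from LinearMap.congr_fun this c
    ext1 v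
    ext1
    obtain ⟨b, w, rfl⟩ : ∃ b w, v = Fin.cons b w := ⟨v 0, Fin.tail v, by simp⟩
    simp only [LinearMap.comp_apply, Finsupp.lsingle_apply, ← cone_single, d_cone, map_sub,
      d_cone_zero, sub_self, LinearMap.zero_apply]
  | succ k ih =>
    suffices d κ (k + 1) ∘ₗ d κ (k + 2) = 0 from LinearMap.congr_fun this c
    ext1 v
    ext1
    obtain ⟨b, w, rfl⟩ : ∃ b w, v = Fin.cons b w := ⟨v 0, Fin.tail v, by simp⟩
    simp only [LinearMap.comp_apply, Finsupp.lsingle_apply, ← cone_single, d_cone, map_sub, ih,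
      map_zero, sub_zero, sub_self, LinearMap.zero_apply]

/-- The chain homotopy between barycentric subdivision and the identity. -/
def T (κ : Type) [Fintype κ] : ∀ k : ℕ, Chains κ k →ₗ[ℚ] Chains κ (k + 1)
  | 0 => 0
  | k + 1 => Finsupp.linearCombination ℚ fun v =>
      cone (bary v) (Finsupp.single v 1 - T κ k (d κ k (Finsupp.single v 1)))

/-- Barycentric subdivision of affine chains. -/
def S (κ : Type) [Fintype κ] : ∀ k : ℕ, Chains κ k →ₗ[ℚ] Chains κ k
  | 0 => LinearMap.id
  | k + 1 => LinearMap.id - d κ (k + 1) ∘ₗ T κ (k + 1) - T κ k ∘ₗ d κ k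

lemma T_single {k : ℕ} (v : Fin (k + 1) → stdSimplex ℝ κ) :
    T κ (k + 1) (Finsupp.single v 1) =
      cone (bary v) (Finsupp.single v 1 - T κ k (d κ k (Finsupp.single v 1))) := by
  simp [T]

lemma S_succ {k : ℕ} (c : Chains κ (k + 1)) :
    S κ (k + 1) c = c - d κ (k + 1) (T κ (k + 1) c) - T κ k (d κ k c) := rfl

/-- This recovers the usual recursive description of subdivision from the definition `id - dT - Td`:
`d_cone` expands `dT`, and `d (v - T d v) = S (d v)` because `d d = 0`. -/
lemma S_single {k : ℕ} (v : Fin (k + 1) → stdSimplex ℝ κ) :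
    S κ (k + 1) (Finsupp.single v 1) = cone (bary v) (S κ k (d κ k (Finsupp.single v 1))) := by
  rw [S_succ, T_single, d_cone]
  have h : d κ k (Finsupp.single v 1 - T κ k (d κ k (Finsupp.single v 1))) =
      S κ k (d κ k (Finsupp.single v 1)) := by
    cases k with
    | zero => simp [T, S]
    | succ k => rw [S_succ, d_d, map_zero, sub_zero, map_sub]
  rw [h]
  abel

/-- The pushforward of affine chains along an affine map. -/
def push {k : ℕ} (w : κ → stdSimplex ℝ μ) : Chains κ k →ₗ[ℚ] Chains μ k :=
  Finsupp.lmapDomain ℚ ℚ (fun v => comb w ∘ v)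

lemma push_single {k : ℕ} (w : κ → stdSimplex ℝ μ) (v : Fin k → stdSimplex ℝ κ) :
    push w (Finsupp.single v 1) = Finsupp.single (comb w ∘ v) 1 := by
  simp [push, Finsupp.mapDomain_single]

lemma push_d {k : ℕ} (w : κ → stdSimplex ℝ μ) (c : Chains κ (k + 1)) :
    push w (d κ k c) = d μ k (push w c) := by
  suffices push w ∘ₗ d κ k = d μ k ∘ₗ push w from LinearMap.congr_fun this c
  ext1 v
  ext1
  simp only [LinearMap.comp_apply, Finsupp.lsingle_apply, d_single, push_single, map_sum, map_smul]
  rfl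

lemma push_cone {k : ℕ} (w : κ → stdSimplex ℝ μ) (b : stdSimplex ℝ κ) (c : Chains κ k) :
    push w (cone b c) = cone (comb w b) (push w c) := by
  suffices push w ∘ₗ cone b = cone (comb w b) ∘ₗ push w from LinearMap.congr_fun this c
  ext1 v
  ext1
  simp only [LinearMap.comp_apply, Finsupp.lsingle_apply, cone_single, push_single]
  congr 1
  ext1 j
  refine Fin.cases ?_ (fun j => ?_) j <;> simp

lemma push_T {k : ℕ} (w : κ → stdSimplex ℝ μ) (c : Chains κ k) :
    push w (T κ k c) = T μ k (push w c) := by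
  induction k with
  | zero => simp [T]
  | succ k ih =>
    suffices push w ∘ₗ T κ (k + 1) = T μ (k + 1) ∘ₗ push w from LinearMap.congr_fun this c
    ext1 v
    ext1
    simp only [LinearMap.comp_apply, Finsupp.lsingle_apply, push_single, T_single, push_cone,
      map_sub, ih, push_d, comb_bary]

/-! ### Mesh of subdivided affine chains -/

/-- Tuples with vertices at pairwise distance at most `D`. -/
def small (κ : Type) [Fintype κ] (k : ℕ) (D : ℝ) : Set (Fin k → stdSimplex ℝ κ) :=
  {w | ∀ i j, dist (w i) (w j) ≤ D}

/-- The containment in the hull of `v` is carried through the induction because it bounds the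
distance from the new apex to the vertices of the subdivided faces. For `k` vertices the factor `k /
(k + 1)` is not sharp, but it is below `1`. -/
lemma S_single_mem {k : ℕ} (v : Fin k → stdSimplex ℝ κ) {D : ℝ} (hv : v ∈ small κ k D) :
    S κ k (Finsupp.single v 1) ∈ Finsupp.supported ℚ ℚ
      (small κ k ((k / (k + 1) : ℝ) * D) ∩ {w | ∀ i, w i ∈ Set.range (comb v)}) := by
  induction k with
  | zero =>
    simp only [S, LinearMap.id_apply]
    refine Finsupp.single_mem_supported _ _ ⟨fun i => i.elim0, fun i => i.elim0⟩
  | succ k ih =>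
    have hD : 0 ≤ D := (dist_nonneg).trans (hv 0 0)
    have h1 : (k / (k + 1) : ℝ) ≤ ((k + 1 : ℕ) / ((k + 1 : ℕ) + 1) : ℝ) := by
      rw [div_le_div_iff₀ (by positivity) (by positivity)]
      push_cast
      nlinarith
    have h1D := mul_le_mul_of_nonneg_right h1 hD
    rw [S_single, d_single, map_sum, map_sum]
    refine Submodule.sum_mem _ fun i _ => ?_
    rw [map_smul, map_smul]
    refine Submodule.smul_mem _ _ ?_
    have hi := ih (v ∘ i.succAbove) fun a b => hv _ _
    have := Finsupp.lmapDomain_supported (R := ℚ) (M := ℚ)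
      (fun w : Fin k → stdSimplex ℝ κ => (Fin.cons (bary v) w : Fin (k + 1) → _))
      (small κ k ((k / (k + 1) : ℝ) * D) ∩ {w | ∀ j, w j ∈ Set.range (comb (v ∘ i.succAbove))})
    refine Finsupp.supported_mono ?_ (this.le (Submodule.mem_map_of_mem hi))
    rintro _ ⟨w, ⟨hw1, hw2⟩, rfl⟩
    have hb : ∀ j, dist (bary v) (w j) ≤ ((k + 1 : ℕ) / ((k + 1 : ℕ) + 1) : ℝ) * D := by
      intro j
      obtain ⟨t, ht⟩ := comb_comp_subset _ _ (hw2 j)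
      rw [← ht, dist_comm]
      refine dist_comb_le _ _ _ fun a => ?_
      rw [dist_comm]
      exact (dist_bary_le v hv a).trans h1D
    refine ⟨fun a b => ?_, fun a => ?_⟩
    · refine Fin.cases ?_ (fun a => ?_) a <;> refine Fin.cases ?_ (fun b => ?_) b
      · simp only [dist_self]; positivity
      · simpa using hb b
      · simpa [dist_comm] using hb a
      · simpa using (hw1 a b).trans h1D
    · refine Fin.cases ?_ (fun a => ?_) a
      · exact ⟨_, rfl⟩
      · simpa using comb_comp_subset _ _ (hw2 a)

lemma S_mem_supported {k : ℕ} {D : ℝ} {c : Chains κ k}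
    (hc : c ∈ Finsupp.supported ℚ ℚ (small κ k D)) :
    S κ k c ∈ Finsupp.supported ℚ ℚ (small κ k ((k / (k + 1) : ℝ) * D)) := by
  rw [Finsupp.supported_eq_span_single] at hc
  induction hc using Submodule.span_induction with
  | mem x hx =>
    obtain ⟨v, hv, rfl⟩ := hx
    exact Finsupp.supported_mono Set.inter_subset_left (S_single_mem v hv)
  | zero => simp
  | add x y _ _ hx hy => rw [map_add]; exact Submodule.add_mem _ hx hy
  | smul a x _ hx => rw [map_smul]; exact Submodule.smul_mem _ _ hx

lemma S_iterate_mem_supported {k : ℕ} (N : ℕ) {D : ℝ} {c : Chains κ k}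
    (hc : c ∈ Finsupp.supported ℚ ℚ (small κ k D)) :
    (S κ k)^[N] c ∈ Finsupp.supported ℚ ℚ (small κ k ((k / (k + 1) : ℝ) ^ N * D)) := by
  induction N with
  | zero => simpa using hc
  | succ N ih =>
    rw [Function.iterate_succ_apply', pow_succ', mul_assoc]
    exact S_mem_supported ih

lemma exists_iterate_mem_supported {k : ℕ} (v : Fin k → stdSimplex ℝ κ) {ε : ℝ} (hε : 0 < ε) :
    ∃ N, (S κ k)^[N] (Finsupp.single v 1) ∈ Finsupp.supported ℚ ℚ
      {w : Fin k → stdSimplex ℝ κ | ∀ i j, dist (w i) (w j) < ε} := by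
  obtain ⟨D, hD⟩ : ∃ D, v ∈ small κ k D := by
    obtain ⟨D, hD⟩ := Metric.isBounded_iff.1
      (isCompact_univ : IsCompact (Set.univ : Set (stdSimplex ℝ κ))).isBounded
    exact ⟨D, fun i j => hD (Set.mem_univ _) (Set.mem_univ _)⟩
  have h : Filter.Tendsto (fun N : ℕ => (k / (k + 1) : ℝ) ^ N * D) Filter.atTop (𝓝 (0 * D)) :=
    (tendsto_pow_atTop_nhds_zero_of_lt_one (by positivity)
      ((div_lt_one (by positivity)).2 (by linarith))).mul_const D
  rw [zero_mul] at h
  obtain ⟨N, hN⟩ := (h.eventually (gt_mem_nhds hε)).exists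
  refine ⟨N, Finsupp.supported_mono ?_ (S_iterate_mem_supported N
    (Finsupp.single_mem_supported ℚ _ hD))⟩
  exact fun w hw i j => (hw i j).trans_lt hN

end AffineChain

/-! ### Subdivision of singular chains -/

namespace SingChain

open AffineChain

variable {X : Type u} [TopologicalSpace X] {k n : ℕ}

/-- Singular chains, indexed by the number of vertices; in degree `0` there is exactly one
simplex, the empty one. -/
abbrev Sing (X : Type u) [TopologicalSpace X] (k : ℕ) : Type u :=
  C(stdSimplex ℝ (Fin k), X) →₀ ℚ

/-- The `i`-th face of a singular simplex. -/
def face (i : Fin (k + 1)) (σ : C(stdSimplex ℝ (Fin (k + 1)), X)) : C(stdSimplex ℝ (Fin k), X) :=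
  σ.comp ⟨stdSimplex.map i.succAbove, stdSimplex.continuous_map _⟩

/-- The boundary of singular chains. -/
def dSing (X : Type u) [TopologicalSpace X] (k : ℕ) : Sing X (k + 1) →ₗ[ℚ] Sing X k :=
  ∑ i : Fin (k + 1), (-1 : ℚ) ^ (i : ℕ) • Finsupp.lmapDomain ℚ ℚ (face i)

lemma dSing_single (σ : C(stdSimplex ℝ (Fin (k + 1)), X)) :
    dSing X k (Finsupp.single σ 1) =
      ∑ i : Fin (k + 1), (-1 : ℚ) ^ (i : ℕ) • Finsupp.single (face i σ) 1 := by
  simp [dSing, LinearMap.sum_apply, Finsupp.lmapDomain_apply, Finsupp.mapDomain_single]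

/-- The affine map with prescribed values at the vertices, as a bundled continuous map. -/
def combMap {ι κ : Type} [Fintype ι] [Fintype κ] (v : ι → stdSimplex ℝ κ) :
    C(stdSimplex ℝ ι, stdSimplex ℝ κ) := ⟨comb v, continuous_comb v⟩

/-- The composition of affine simplices with a singular simplex. -/
def real (k : ℕ) (σ : C(stdSimplex ℝ (Fin n), X)) : Chains (Fin n) k →ₗ[ℚ] Sing X k :=
  Finsupp.lmapDomain ℚ ℚ (fun v => σ.comp (combMap v))

lemma real_single (σ : C(stdSimplex ℝ (Fin n), X)) (v : Fin k → stdSimplex ℝ (Fin n)) :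
    real k σ (Finsupp.single v 1) = Finsupp.single (σ.comp (combMap v)) 1 := by
  simp [real, Finsupp.mapDomain_single]

lemma face_comp_combMap (σ : C(stdSimplex ℝ (Fin n), X))
    (v : Fin (k + 1) → stdSimplex ℝ (Fin n)) (i : Fin (k + 1)) :
    face i (σ.comp (combMap v)) = σ.comp (combMap (v ∘ i.succAbove)) := by
  ext t
  change σ (comb v (stdSimplex.map i.succAbove t)) = σ (comb (v ∘ i.succAbove) t)
  rw [map_eq_comb, comb_comb]
  congr 2
  ext1 j
  simp [comb_vertex]

lemma real_d (σ : C(stdSimplex ℝ (Fin n), X)) (c : Chains (Fin n) (k + 1)) :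
    real k σ (d (Fin n) k c) = dSing X k (real (k + 1) σ c) := by
  suffices real k σ ∘ₗ d (Fin n) k = dSing X k ∘ₗ real (k + 1) σ from LinearMap.congr_fun this c
  ext1 v
  ext1
  simp only [LinearMap.comp_apply, Finsupp.lsingle_apply, d_single, map_sum, map_smul, real_single,
    dSing_single, face_comp_combMap]

lemma real_push {m : ℕ} (σ : C(stdSimplex ℝ (Fin n), X)) (w : Fin m → stdSimplex ℝ (Fin n))
    (c : Chains (Fin m) k) : real k σ (push w c) = real k (σ.comp (combMap w)) c := by
  suffices real k σ ∘ₗ push w = real k (σ.comp (combMap w)) from LinearMap.congr_fun this c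
  ext1 v
  ext1
  simp only [LinearMap.comp_apply, Finsupp.lsingle_apply, push_single, real_single]
  congr 1
  ext t
  exact congrArg σ (comb_comb w v t).symm

/-- The identity of the standard simplex, as an affine simplex. -/
def idChain (k : ℕ) : Chains (Fin k) k := Finsupp.single (fun i => stdSimplex.vertex i) 1

lemma push_idChain (w : Fin k → stdSimplex ℝ (Fin n)) :
    push w (idChain k) = Finsupp.single w 1 := by
  rw [idChain, push_single]
  congr 1
  ext1 i
  exact comb_vertex w i

lemma real_idChain (σ : C(stdSimplex ℝ (Fin k), X)) :
    real k σ (idChain k) = Finsupp.single σ 1 := by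
  rw [idChain, real_single]
  congr 1
  ext t
  exact congrArg σ (comb_vertices t)

/-- The natural chain homotopy between subdivision and the identity. -/
def TSing (X : Type u) [TopologicalSpace X] (k : ℕ) : Sing X k →ₗ[ℚ] Sing X (k + 1) :=
  Finsupp.linearCombination ℚ fun σ => real (k + 1) σ (T (Fin k) k (idChain k))

lemma TSing_single (σ : C(stdSimplex ℝ (Fin k), X)) :
    TSing X k (Finsupp.single σ 1) = real (k + 1) σ (T (Fin k) k (idChain k)) := by
  simp [TSing]

/-- `TSing` is defined from the identity simplex alone; compatibility with all affine chains is the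
naturality `push_T`. -/
lemma real_T (σ : C(stdSimplex ℝ (Fin n), X)) (c : Chains (Fin n) k) :
    real (k + 1) σ (T (Fin n) k c) = TSing X k (real k σ c) := by
  suffices real (k + 1) σ ∘ₗ T (Fin n) k = TSing X k ∘ₗ real k σ from LinearMap.congr_fun this c
  ext1 v
  ext1
  simp only [LinearMap.comp_apply, Finsupp.lsingle_apply, real_single, TSing_single]
  rw [← real_push, push_T, push_idChain]

/-- Barycentric subdivision of singular chains. -/
def SSing (X : Type u) [TopologicalSpace X] (k : ℕ) : Sing X (k + 1) →ₗ[ℚ] Sing X (k + 1) :=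
  LinearMap.id - dSing X (k + 1) ∘ₗ TSing X (k + 1) - TSing X k ∘ₗ dSing X k

lemma SSing_apply (c : Sing X (k + 1)) : SSing X k c =
    c - dSing X (k + 1) (TSing X (k + 1) c) - TSing X k (dSing X k c) := rfl

lemma real_S (σ : C(stdSimplex ℝ (Fin n), X)) (c : Chains (Fin n) (k + 1)) :
    real (k + 1) σ (S (Fin n) (k + 1) c) = SSing X k (real (k + 1) σ c) := by
  rw [S_succ, SSing_apply, map_sub, map_sub, real_d, real_T, real_T, real_d]

lemma real_S_iterate (σ : C(stdSimplex ℝ (Fin n), X)) (N : ℕ) (c : Chains (Fin n) (k + 1)) :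
    real (k + 1) σ ((S (Fin n) (k + 1))^[N] c) = (SSing X k)^[N] (real (k + 1) σ c) := by
  induction N with
  | zero => rfl
  | succ N ih => rw [Function.iterate_succ_apply', Function.iterate_succ_apply', real_S, ih]

lemma dSing_dSing (c : Sing X (k + 2)) : dSing X k (dSing X (k + 1) c) = 0 := by
  suffices dSing X k ∘ₗ dSing X (k + 1) = 0 from LinearMap.congr_fun this c
  ext1 σ
  ext1
  simp only [LinearMap.comp_apply, Finsupp.lsingle_apply]
  rw [← real_idChain σ, ← real_d, ← real_d, d_d, map_zero, LinearMap.zero_apply]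

/-! ### Chains subordinate to a cover -/

variable {α : Type*} (U : α → Set X)

/-- The singular chains subordinate to a family of subsets. -/
def smallChains (k : ℕ) : Submodule ℚ (Sing X k) :=
  Finsupp.supported ℚ ℚ {σ | ∃ a, Set.range σ ⊆ U a}

variable {U}

/-- An operator that does not enlarge images of simplices preserves subordination; this serves both
`dSing` and `TSing`. -/
lemma map_mem_smallChains {l : ℕ} (f : Sing X k →ₗ[ℚ] Sing X l)
    (hf : ∀ σ : C(stdSimplex ℝ (Fin k), X), f (Finsupp.single σ 1) ∈
      Finsupp.supported ℚ ℚ {τ : C(stdSimplex ℝ (Fin l), X) | Set.range τ ⊆ Set.range σ})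
    {c : Sing X k} (hc : c ∈ smallChains U k) : f c ∈ smallChains U l := by
  rw [smallChains, Finsupp.supported_eq_span_single] at hc
  induction hc using Submodule.span_induction with
  | mem x hx =>
    obtain ⟨σ, ⟨a, ha⟩, rfl⟩ := hx
    refine Finsupp.supported_mono ?_ (hf σ)
    intro τ hτ
    exact ⟨a, Set.Subset.trans hτ ha⟩
  | zero => simp
  | add x y _ _ hx hy => rw [map_add]; exact Submodule.add_mem _ hx hy
  | smul a x _ hx => rw [map_smul]; exact Submodule.smul_mem _ _ hx

lemma dSing_mem_smallChains {c : Sing X (k + 1)} (hc : c ∈ smallChains U (k + 1)) :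
    dSing X k c ∈ smallChains U k := by
  refine map_mem_smallChains _ (fun σ => ?_) hc
  rw [dSing_single]
  refine Submodule.sum_mem _ fun i _ => Submodule.smul_mem _ _ (Finsupp.single_mem_supported _ _ ?_)
  rintro _ ⟨t, rfl⟩
  exact ⟨_, rfl⟩

lemma real_mem_supported (σ : C(stdSimplex ℝ (Fin n), X)) {s : Set (Fin k → stdSimplex ℝ (Fin n))}
    {t : Set C(stdSimplex ℝ (Fin k), X)} (h : ∀ v ∈ s, σ.comp (combMap v) ∈ t)
    {c : Chains (Fin n) k} (hc : c ∈ Finsupp.supported ℚ ℚ s) :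
    real k σ c ∈ Finsupp.supported ℚ ℚ t := by
  refine Finsupp.supported_mono ?_
    ((Finsupp.lmapDomain_supported (R := ℚ) (M := ℚ) _ s).le (Submodule.mem_map_of_mem hc))
  rintro _ ⟨v, hv, rfl⟩
  exact h v hv

lemma TSing_mem_smallChains {c : Sing X k} (hc : c ∈ smallChains U k) :
    TSing X k c ∈ smallChains U (k + 1) := by
  refine map_mem_smallChains _ (fun σ => ?_) hc
  rw [TSing_single]
  refine real_mem_supported σ (s := Set.univ) ?_ (by simp)
  rintro v - _ ⟨t, rfl⟩
  exact ⟨_, rfl⟩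

lemma SSing_mem_smallChains {c : Sing X (k + 1)} (hc : c ∈ smallChains U (k + 1)) :
    SSing X k c ∈ smallChains U (k + 1) := by
  rw [SSing_apply]
  exact Submodule.sub_mem _ (Submodule.sub_mem _ hc
    (dSing_mem_smallChains (TSing_mem_smallChains hc)))
    (TSing_mem_smallChains (dSing_mem_smallChains hc))

lemma SSing_iterate_mem_smallChains {c : Sing X (k + 1)} (hc : c ∈ smallChains U (k + 1)) (N : ℕ) :
    (SSing X k)^[N] c ∈ smallChains U (k + 1) := by
  induction N with
  | zero => exact hc
  | succ N ih => rw [Function.iterate_succ_apply']; exact SSing_mem_smallChains ih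

lemma exists_SSing_iterate_single_mem (hU : ∀ a, IsOpen (U a)) (hcov : ⋃ a, U a = Set.univ)
    (σ : C(stdSimplex ℝ (Fin (k + 1)), X)) :
    ∃ N, (SSing X k)^[N] (Finsupp.single σ 1) ∈ smallChains U (k + 1) := by
  obtain ⟨ε, hε, h⟩ := lebesgue_number_lemma_of_metric
    (isCompact_univ : IsCompact (Set.univ : Set (stdSimplex ℝ (Fin (k + 1)))))
    (c := fun a => σ ⁻¹' U a) (fun a => (hU a).preimage σ.continuous)
    (by rw [← Set.preimage_iUnion, hcov, Set.preimage_univ])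
  obtain ⟨N, hN⟩ := exists_iterate_mem_supported
    (fun i : Fin (k + 1) => stdSimplex.vertex (S := ℝ) i) (half_pos hε)
  refine ⟨N, ?_⟩
  rw [← real_idChain, ← real_S_iterate]
  refine real_mem_supported σ (fun v hv => ?_) hN
  obtain ⟨a, ha⟩ := h (v 0) (Set.mem_univ _)
  refine ⟨a, ?_⟩
  rintro _ ⟨t, rfl⟩
  -- The mesh is below `ε / 2`, so by convexity the whole affine simplex lies in the Lebesgue ball
  -- around its vertex `v 0`.
  refine ha (Metric.mem_ball.2 ((dist_comb_le v t _ fun i => (hv i 0).le).trans_lt (half_lt_self hε)))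

lemma exists_SSing_iterate_mem (hU : ∀ a, IsOpen (U a)) (hcov : ⋃ a, U a = Set.univ)
    (c : Sing X (k + 1)) : ∃ N, (SSing X k)^[N] c ∈ smallChains U (k + 1) := by
  -- Asking for all large `M` lets a sum use the maximum of two exponents.
  suffices ∃ N, ∀ M, N ≤ M → (SSing X k)^[M] c ∈ smallChains U (k + 1) from
    this.imp fun N h => h N le_rfl
  induction c using Finsupp.induction_linear with
  | zero => exact ⟨0, fun M _ => by simp [iterate_map_zero]⟩
  | add f g hf hg =>
    obtain ⟨N, hN⟩ := hf
    obtain ⟨N', hN'⟩ := hg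
    refine ⟨max N N', fun M hM => ?_⟩
    rw [iterate_map_add]
    exact Submodule.add_mem _ (hN M ((le_max_left _ _).trans hM))
      (hN' M ((le_max_right _ _).trans hM))
  | single σ r =>
    obtain ⟨N, hN⟩ := exists_SSing_iterate_single_mem hU hcov σ
    refine ⟨N, fun M hM => ?_⟩
    obtain ⟨j, rfl⟩ := Nat.exists_eq_add_of_le' hM
    rw [← mul_one r, ← smul_eq_mul, ← Finsupp.smul_single, ← Module.End.pow_apply, map_smul,
      Module.End.pow_apply, Function.iterate_add_apply]
    exact Submodule.smul_mem _ _ (SSing_iterate_mem_smallChains hN j)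

/-- A singular chain whose boundary is subordinate to an open cover becomes subordinate to it
after adding a boundary. -/
theorem exists_add_dSing_mem_smallChains (hU : ∀ a, IsOpen (U a)) (hcov : ⋃ a, U a = Set.univ)
    (c : Sing X (k + 1)) (hc : dSing X k c ∈ smallChains U k) :
    ∃ e, c + dSing X (k + 1) e ∈ smallChains U (k + 1) := by
  obtain ⟨N, hN⟩ := exists_SSing_iterate_mem hU hcov c
  induction N generalizing c with
  | zero => exact ⟨0, by simpa using hN⟩
  | succ N ih =>
    have hd : dSing X k (SSing X k c) ∈ smallChains U k := by
      rw [SSing_apply, map_sub, map_sub, dSing_dSing, sub_zero]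
      exact Submodule.sub_mem _ hc (dSing_mem_smallChains (TSing_mem_smallChains hc))
    obtain ⟨e, he⟩ := ih (SSing X k c) hd hN
    -- Since `c = SSing c + d T c + T d c`, the term `d T c` is absorbed into the boundary, while `T
    -- d c` is already subordinate because `d c` is.
    refine ⟨e - TSing X (k + 1) c, ?_⟩
    have := Submodule.add_mem _ he (TSing_mem_smallChains hc)
    rw [SSing_apply] at this
    rw [map_sub]
    convert this using 1
    abel

end SingChain

/-! ### Comparison with the singular chain complex -/

namespace SSet

open Limits Simplicial

/-- The coefficients of rational chains. -/
abbrev ratCoeff : ModuleCat.{u} ℚ := ModuleCat.of ℚ (ULift.{u} ℚ)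

variable (K L : SSet.{u}) (n : ℕ)

/-- The comparison of explicit simplicial chains with the simplicial chain complex. -/
def finsuppToChains : (K _⦋n⦌ →₀ ℚ) →ₗ[ℚ] (K.chainComplex ratCoeff.{u}).X n :=
  Finsupp.linearCombination ℚ fun x => (K.ιChainComplex (R := ratCoeff.{u}) x).hom (ULift.up 1)

lemma finsuppToChains_single (x : K _⦋n⦌) :
    K.finsuppToChains n (Finsupp.single x 1) =
      (K.ιChainComplex (R := ratCoeff.{u}) x).hom (ULift.up 1) := by
  rw [finsuppToChains, Finsupp.linearCombination_single, one_smul]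

/-- The inverse of the comparison map. -/
def chainsToFinsupp : (K.chainComplex ratCoeff.{u}).X n ⟶ ModuleCat.of ℚ (K _⦋n⦌ →₀ ℚ) :=
  Cofan.IsColimit.desc (K.isColimitChainComplexXCofan ratCoeff.{u} n) fun x =>
    ModuleCat.ofHom (Finsupp.lsingle (R := ℚ) (M := ℚ) x ∘ₗ ULift.moduleEquiv.toLinearMap)

lemma ι_chainsToFinsupp (x : K _⦋n⦌) : K.ιChainComplex x ≫ K.chainsToFinsupp n =
      ModuleCat.ofHom (Finsupp.lsingle (R := ℚ) (M := ℚ) x ∘ₗ ULift.moduleEquiv.toLinearMap) :=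
  Cofan.IsColimit.fac (K.isColimitChainComplexXCofan ratCoeff.{u} n) _ x

/-- The chain module is a coproduct of copies of the coefficients indexed by simplices; its
universal property supplies the inverse. -/
lemma finsuppToChains_bijective : Function.Bijective (K.finsuppToChains n) := by
  have h1 : (K.chainsToFinsupp n).hom ∘ₗ K.finsuppToChains n = LinearMap.id := by
    ext1 x
    ext1
    simp only [LinearMap.comp_apply, Finsupp.lsingle_apply, LinearMap.id_apply,
      finsuppToChains_single]
    exact LinearMap.congr_fun (congrArg ModuleCat.Hom.hom (K.ι_chainsToFinsupp n x)) (ULift.up 1)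
  have h2 : K.chainsToFinsupp n ≫ ModuleCat.ofHom (K.finsuppToChains n) = 𝟙 _ := by
    refine SSet.chainComplex_hom_ext fun x => ?_
    rw [← Category.assoc, ι_chainsToFinsupp]
    ext r
    change K.finsuppToChains n (Finsupp.single x r.down) =
      (K.ιChainComplex (R := ratCoeff.{u}) x).hom r
    rw [← mul_one r.down, ← smul_eq_mul, ← Finsupp.smul_single, map_smul,
      finsuppToChains_single, ← map_smul]
    congr 1
    ext
    simp
  exact ⟨Function.LeftInverse.injective (g := (K.chainsToFinsupp n).hom)
    (fun c => LinearMap.congr_fun h1 c),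
    Function.RightInverse.surjective (g := (K.chainsToFinsupp n).hom)
    (fun c => LinearMap.congr_fun (congrArg ModuleCat.Hom.hom h2) c)⟩

lemma d_finsuppToChains_single (x : K _⦋n + 1⦌) :
    ((K.chainComplex ratCoeff.{u}).d (n + 1) n).hom (K.finsuppToChains (n + 1) (Finsupp.single x 1)) =
      ∑ i : Fin (n + 2), (-1 : ℚ) ^ (i : ℕ) •
        K.finsuppToChains n (Finsupp.single (K.δ i x) 1) := by
  simp only [finsuppToChains_single]
  refine (LinearMap.congr_fun (congrArg ModuleCat.Hom.hom
    (K.ιChainComplex_d (R := ratCoeff.{u}) x)) (ULift.up 1)).trans ?_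
  simp only [ModuleCat.hom_sum, LinearMap.sum_apply]
  refine Finset.sum_congr rfl fun i _ => ?_
  rw [ModuleCat.hom_zsmul, LinearMap.smul_apply, ← Int.cast_smul_eq_zsmul ℚ]
  push_cast
  rfl

variable {K L}

lemma map_finsuppToChains_single (f : K ⟶ L) (x : K _⦋n⦌) :
    ((SSet.chainComplexMap f ratCoeff.{u}).f n).hom (K.finsuppToChains n (Finsupp.single x 1)) =
      L.finsuppToChains n (Finsupp.single (f.app _ x) 1) := by
  simp only [finsuppToChains_single]
  exact LinearMap.congr_fun (congrArg ModuleCat.Hom.hom (SSet.ι_chainComplexMap_f _ _ f ratCoeff.{u} x))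
    (ULift.up 1)

end SSet

namespace SingChain

open Limits Opposite

/-- The comparison of explicit singular chains with the singular chain complex. -/
def toChains (X : TopCat.{u}) (n : ℕ) : Sing X (n + 1) →ₗ[ℚ] (rationalSingularChains.obj X).X n :=
  ((TopCat.toSSet.obj X).finsuppToChains n) ∘ₗ
    (Finsupp.domLCongr (TopCat.toSSetObjEquiv X (op (SimplexCategory.mk n))).symm).toLinearMap

lemma toChains_single (X : TopCat.{u}) (n : ℕ)
    (x : (TopCat.toSSet.obj X).obj (op (SimplexCategory.mk n))) :
    toChains X n (Finsupp.single (TopCat.toSSetObjEquiv X (op (SimplexCategory.mk n)) x) 1) =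
      (TopCat.toSSet.obj X).finsuppToChains n (Finsupp.single x 1) := by
  refine congrArg ((TopCat.toSSet.obj X).finsuppToChains n) ?_
  refine (Finsupp.domLCongr_single (R := ℚ) (M := ℚ) _ _ _).trans ?_
  exact congrArg (fun y => Finsupp.single y (1 : ℚ)) (Equiv.symm_apply_apply _ x)

lemma toChains_bijective (X : TopCat.{u}) (n : ℕ) : Function.Bijective (toChains X n) :=
  ((TopCat.toSSet.obj X).finsuppToChains_bijective n).comp (LinearEquiv.bijective _)

lemma toChains_d (X : TopCat.{u}) (n : ℕ) (c : Sing X (n + 2)) :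
    ((rationalSingularChains.obj X).d (n + 1) n).hom (toChains X (n + 1) c) =
      toChains X n (dSing X (n + 1) c) := by
  suffices ((rationalSingularChains.obj X).d (n + 1) n).hom ∘ₗ toChains X (n + 1) =
      toChains X n ∘ₗ dSing X (n + 1) from LinearMap.congr_fun this c
  ext1 σ
  ext1
  obtain ⟨x, rfl⟩ := (TopCat.toSSetObjEquiv X (op (SimplexCategory.mk (n + 1)))).surjective σ
  refine (congrArg _ (toChains_single X (n + 1) x)).trans
    (((TopCat.toSSet.obj X).d_finsuppToChains_single n x).trans ?_)
  refine Eq.trans ?_ (congrArg (toChains X n) (dSing_single _).symm)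
  rw [map_sum]
  refine Finset.sum_congr rfl fun i _ => ?_
  rw [map_smul]
  exact congrArg _ (toChains_single X n _).symm

/-- The pushforward of singular chains. -/
def mapSing {X Y : Type u} [TopologicalSpace X] [TopologicalSpace Y] (f : C(X, Y)) (k : ℕ) :
    Sing X k →ₗ[ℚ] Sing Y k := Finsupp.lmapDomain ℚ ℚ (fun σ => f.comp σ)

lemma mapSing_single {X Y : Type u} [TopologicalSpace X] [TopologicalSpace Y] (f : C(X, Y))
    {k : ℕ} (σ : C(stdSimplex ℝ (Fin k), X)) :
    mapSing f k (Finsupp.single σ 1) = Finsupp.single (f.comp σ) 1 := by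
  simp [mapSing, Finsupp.mapDomain_single]

lemma toChains_map {X Y : TopCat.{u}} (f : X ⟶ Y) (n : ℕ) (c : Sing X (n + 1)) :
    ((rationalSingularChains.map f).f n).hom (toChains X n c) =
      toChains Y n (mapSing f.hom (n + 1) c) := by
  suffices ((rationalSingularChains.map f).f n).hom ∘ₗ toChains X n =
      toChains Y n ∘ₗ mapSing f.hom (n + 1) from LinearMap.congr_fun this c
  ext1 σ
  ext1
  obtain ⟨x, rfl⟩ := (TopCat.toSSetObjEquiv X (op (SimplexCategory.mk n))).surjective σ
  refine (congrArg _ (toChains_single X n x)).trans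
    ((SSet.map_finsuppToChains_single n (TopCat.toSSet.map f) x).trans ?_)
  refine Eq.trans (toChains_single Y n _).symm (congrArg (toChains Y n) ?_)
  exact (mapSing_single f.hom (k := n + 1)
    (TopCat.toSSetObjEquiv X (op (SimplexCategory.mk n)) x)).symm

/-- The singular simplices with image in a subset. -/
def simplicesIn {X : Type u} [TopologicalSpace X] (k : ℕ) (A : Set X) :
    Set C(stdSimplex ℝ (Fin k), X) := {σ | Set.range σ ⊆ A}

lemma exists_mapSing_eq {X Y : Type u} [TopologicalSpace X] [TopologicalSpace Y] (f : C(X, Y))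
    (hf : Topology.IsEmbedding f) {k : ℕ} {c : Sing Y k}
    (hc : c ∈ Finsupp.supported ℚ ℚ (simplicesIn k (Set.range f))) :
    ∃ z, mapSing f k z = c := by
  have h : simplicesIn k (Set.range f) ⊆
      (fun σ : C(stdSimplex ℝ (Fin k), X) => f.comp σ) '' Set.univ := by
    intro σ hσ
    choose g hg using fun t => hσ (Set.mem_range_self t)
    have hgc : Continuous g := by
      rw [hf.continuous_iff]
      convert σ.continuous using 1
      ext1 t
      exact hg t
    exact ⟨⟨g, hgc⟩, trivial, ContinuousMap.ext hg⟩
  obtain ⟨z, -, hz⟩ := (Finsupp.lmapDomain_supported (R := ℚ) (M := ℚ) _ _).ge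
    (Finsupp.supported_mono h hc)
  exact ⟨z, hz⟩

lemma mapSing_mem_supported {X Y : Type u} [TopologicalSpace X] [TopologicalSpace Y] (f : C(X, Y))
    {k : ℕ} (c : Sing X k) : mapSing f k c ∈
      Finsupp.supported ℚ ℚ (simplicesIn k (Set.range f)) := by
  refine Finsupp.supported_mono ?_ ((Finsupp.lmapDomain_supported (R := ℚ) (M := ℚ) _ Set.univ).le
    (Submodule.mem_map_of_mem (by simp)))
  rintro _ ⟨σ, -, rfl⟩ _ ⟨t, rfl⟩
  exact ⟨_, rfl⟩

/-! ### Chain-level input for excision -/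

section Excision

variable {P A W X : TopCat.{u}} (p : P ⟶ A) (q : P ⟶ W) (a : A ⟶ X) (w : W ⟶ X)

/-- This gives injectivity of the excision map on quotient complexes: a chain of `W` that comes from
`A` inside `X` is supported on simplices in the overlap, hence comes from `P`. -/
lemma exists_lift_of_map_eq (hq : Topology.IsEmbedding q) (hw : Topology.IsEmbedding w)
    (hP : ∀ x y, a x = w y → ∃ z, q z = y) (n : ℕ)
    (c : (rationalSingularChains.obj W).X n) (c' : (rationalSingularChains.obj A).X n)
    (h : ((rationalSingularChains.map w).f n).hom c =
      ((rationalSingularChains.map a).f n).hom c') :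
    ∃ z, ((rationalSingularChains.map q).f n).hom z = c := by
  obtain ⟨c, rfl⟩ := (toChains_bijective W n).2 c
  obtain ⟨c', rfl⟩ := (toChains_bijective A n).2 c'
  rw [toChains_map, toChains_map] at h
  replace h := (toChains_bijective X n).1 h
  have hc : c ∈ Finsupp.supported ℚ ℚ (simplicesIn (n + 1) (Set.range q.hom)) := by
    have h2 := mapSing_mem_supported a.hom c'
    rw [← h, Finsupp.mem_supported, mapSing, Finsupp.lmapDomain_apply] at h2
    intro σ hσ
    -- Injectivity on simplices rules out cancellation, so each simplex in the support of `c`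
    -- survives in the pushforward.
    have hinj : Function.Injective (fun σ : C(stdSimplex ℝ (Fin (n + 1)), W) => w.hom.comp σ) :=
      fun σ τ hst => ContinuousMap.ext fun t => hw.injective (congrArg (fun f => f t) hst)
    have h3 : w.hom.comp σ ∈ (Finsupp.mapDomain (fun σ => w.hom.comp σ) c).support := by
      rw [Finsupp.mem_support_iff, Finsupp.mapDomain_apply hinj]
      exact Finsupp.mem_support_iff.1 hσ
    rintro _ ⟨t, rfl⟩
    obtain ⟨x, hx⟩ := h2 h3 ⟨t, rfl⟩
    exact hP x _ hx
  obtain ⟨z, rfl⟩ := exists_mapSing_eq q.hom hq hc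
  exact ⟨toChains P n z, toChains_map _ _ _⟩

lemma exists_add_d_eq (ha : Topology.IsOpenEmbedding a) (hw : Topology.IsOpenEmbedding w)
    (hcov : Set.range a ∪ Set.range w = Set.univ) (n : ℕ)
    (c : (rationalSingularChains.obj X).X n)
    (hc : ∃ y z, ((rationalSingularChains.obj X).d n ((ComplexShape.down ℕ).next n)).hom c =
      ((rationalSingularChains.map a).f _).hom y + ((rationalSingularChains.map w).f _).hom z) :
    ∃ e y z, c + ((rationalSingularChains.obj X).d (n + 1) n).hom e =
      ((rationalSingularChains.map a).f n).hom y +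
        ((rationalSingularChains.map w).f n).hom z := by
  let U : Bool → Set X := fun b => if b then Set.range a else Set.range w
  have hU : ∀ b, IsOpen (U b) := by
    rintro (_ | _)
    · exact hw.isOpen_range
    · exact ha.isOpen_range
  have hUcov : ⋃ b, U b = Set.univ := by
    rw [← hcov]
    ext x
    simp [U, or_comm]
  have hsmall : ∀ k, smallChains U k =
      Finsupp.supported ℚ ℚ (simplicesIn k (Set.range a.hom)) ⊔
      Finsupp.supported ℚ ℚ (simplicesIn k (Set.range w.hom)) := by
    intro k
    rw [← Finsupp.supported_union, smallChains]
    congr 1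
    ext σ
    simp [U, or_comm]
    rfl
  obtain ⟨c, rfl⟩ := (toChains_bijective X n).2 c
  have hc' : dSing X n c ∈ smallChains U n := by
    cases n with
    | zero =>
      -- In degree zero the augmented boundary only involves the empty simplex, which is subordinate
      -- to either set.
      intro σ _
      refine ⟨true, ?_⟩
      rintro _ ⟨t, rfl⟩
      exact absurd t.2.2 (by simp)
    | succ n =>
      rw [ChainComplex.next_nat_succ] at hc
      obtain ⟨y, z, h⟩ := hc
      obtain ⟨y, rfl⟩ := (toChains_bijective A n).2 y
      obtain ⟨z, rfl⟩ := (toChains_bijective W n).2 z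
      rw [toChains_d, toChains_map, toChains_map, ← map_add] at h
      rw [(toChains_bijective X n).1 h, hsmall]
      exact Submodule.add_mem_sup (mapSing_mem_supported _ _) (mapSing_mem_supported _ _)
  obtain ⟨e, he⟩ := exists_add_dSing_mem_smallChains hU hUcov c hc'
  rw [hsmall] at he
  obtain ⟨y, hy, z, hz, hyz⟩ := Submodule.mem_sup.1 he
  obtain ⟨y, rfl⟩ := exists_mapSing_eq a.hom ha.isEmbedding hy
  obtain ⟨z, rfl⟩ := exists_mapSing_eq w.hom hw.isEmbedding hz
  refine ⟨toChains X (n + 1) e, toChains A n y, toChains W n z, ?_⟩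
  rw [toChains_d, toChains_map, toChains_map, ← map_add, ← map_add, hyz]

end Excision

end SingChain

/-! ### Homological algebra of relative complexes -/

namespace RelHomology

open Limits HomologicalComplex

section Abelian

variable {C : Type*} [Category C] [Abelian C] {ι : Type*} {c : ComplexShape ι}

lemma shortExact_cokernel {K L : HomologicalComplex C c} (f : K ⟶ L) [Mono f] :
    (ShortComplex.mk f (cokernel.π f) (cokernel.condition f)).ShortExact where
  exact := ShortComplex.exact_cokernel f

lemma quasiIso_cokernel_map {K L K' L' : HomologicalComplex C c} (f : K ⟶ L) (f' : K' ⟶ L')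
    [Mono f] [Mono f'] (φ : K ⟶ K') (ψ : L ⟶ L') (h : f ≫ ψ = φ ≫ f')
    (hφ : QuasiIso φ) (hψ : QuasiIso ψ) : QuasiIso (cokernel.map f f' φ ψ h) := by
  let θ : ShortComplex.mk f (cokernel.π f) (cokernel.condition f) ⟶
      ShortComplex.mk f' (cokernel.π f') (cokernel.condition f') :=
    { τ₁ := φ
      τ₂ := ψ
      τ₃ := cokernel.map f f' φ ψ h
      comm₁₂ := h.symm
      comm₂₃ := by simp }
  exact HomologySequence.quasiIso_τ₃ θ (shortExact_cokernel f) (shortExact_cokernel f') hφ hψ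

lemma shortExact_cokernel_comp {A : Type*} [Category A] [Abelian A] {X Y Z : A}
    (f : X ⟶ Y) (g : Y ⟶ Z) [Mono g] :
    (ShortComplex.mk (cokernel.map f (f ≫ g) (𝟙 X) g (by simp))
      (cokernel.map (f ≫ g) g f (𝟙 Z) (by simp)) (by ext; simp)).ShortExact where
  exact := (kernelCokernelCompSequence_exact f g).exact 3
  mono_f := by
    have := ((kernelCokernelCompSequence_exact f g).exact 2).mono_g
      ((isZero_kernel_of_mono g).eq_of_src _ _)
    exact this
  epi_g := epi_of_epi_fac (f := cokernel.π (f ≫ g)) (h := cokernel.π g) (by simp)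

/-- In the long exact sequence the terms next to `H(S.f)` vanish. An index with no predecessor has
no incoming connecting map, so injectivity there is argued separately. -/
lemma shortExact_quasiIso_f {S : ShortComplex (HomologicalComplex C c)} (hS : S.ShortExact)
    (h : S.X₃.Acyclic) : QuasiIso S.f := by
  have hz : ∀ i, IsZero (S.X₃.homology i) := fun i => (h i).isZero_homology
  refine ⟨fun i => (quasiIsoAt_iff_isIso_homologyMap _ _).2 ?_⟩
  have : Epi (homologyMap S.f i) := (hS.homology_exact₂ i).epi_f ((hz i).eq_of_tgt _ _)
  have : Mono (homologyMap S.f i) := by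
    by_cases! hi : ∃ j, c.Rel j i
    · obtain ⟨j, hj⟩ := hi
      exact (hS.homology_exact₁ j i hj).mono_g ((hz j).eq_of_src _ _)
    · have := hS.mono_f
      exact mono_homologyMap_of_mono_of_not_rel S.f i hi
  exact isIso_of_mono_of_epi _

/-- The connecting isomorphism of the triple given by two monomorphisms whose composition is a
quasi-isomorphism. -/
def homologyIsoOfQuasiIsoComp {X Y Z : HomologicalComplex C c} (f : X ⟶ Y) (g : Y ⟶ Z) [Mono f]
    [Mono g] (h : QuasiIso (f ≫ g)) (i j : ι) (hij : c.Rel i j) :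
    (cokernel g).homology i ≅ (cokernel f).homology j :=
  -- The middle term `Z/X` of `0 → Y/X → Z/X → Z/Y → 0` is acyclic, so the connecting map is an
  -- isomorphism.
  have hac := (shortExact_cokernel (f ≫ g)).acyclic_X₃ h
  (shortExact_cokernel_comp f g).δIso i j hij (hac i).isZero_homology (hac j).isZero_homology

/-- The isomorphism in homology induced by a quasi-isomorphism. -/
def homologyIsoOfQuasiIso {K L : HomologicalComplex C c} {f : K ⟶ L} (h : QuasiIso f) (i : ι) :
    K.homology i ≅ L.homology i := isoOfQuasiIsoAt f i

end Abelian

section Module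

variable {K L : ChainComplex (ModuleCat.{u} ℚ) ℕ}

lemma exists_of_π_eq_zero (f : K ⟶ L) (n : ℕ) (x : L.X n) (hx : ((cokernel.π f).f n).hom x = 0) :
    ∃ y, (f.f n).hom y = x := by
  have h := (ShortComplex.exact_cokernel f).map (HomologicalComplex.eval _ _ n)
  exact (ShortComplex.moduleCat_exact_iff _).1 h x hx

lemma π_surjective (f : K ⟶ L) (n : ℕ) : Function.Surjective ((cokernel.π f).f n).hom :=
  (ModuleCat.epi_iff_surjective _).1 inferInstance

lemma f_comm_apply (f : K ⟶ L) (i j : ℕ) (x : K.X i) :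
    (L.d i j).hom ((f.f i).hom x) = (f.f j).hom ((K.d i j).hom x) :=
  LinearMap.congr_fun (congrArg ModuleCat.Hom.hom (f.comm i j)) x

/-- The second hypothesis is acyclicity of the cokernel at the level of representatives: every cycle
relative to `K` is, up to a boundary, in the image of `K`. -/
lemma quasiIso_of_injective (φ : K ⟶ L) (hinj : ∀ n, Function.Injective (φ.f n).hom)
    (h : ∀ n (x : L.X n),
      (∃ z, (L.d n ((ComplexShape.down ℕ).next n)).hom x = (φ.f _).hom z) →
      ∃ y z, x + (L.d (n + 1) n).hom y = (φ.f n).hom z) : QuasiIso φ := by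
  have (n : ℕ) : Mono (φ.f n) := (ModuleCat.mono_iff_injective _).2 (hinj n)
  have : Mono φ := mono_of_mono_f φ inferInstance
  refine shortExact_quasiIso_f (shortExact_cokernel φ) fun n => ?_
  rw [exactAt_iff' _ (n + 1) n _ (ChainComplex.prev ℕ n) rfl, ShortComplex.moduleCat_exact_iff]
  intro x hx
  obtain ⟨x, rfl⟩ := π_surjective φ n x
  replace hx : ((cokernel φ).d n _).hom (((cokernel.π φ).f n).hom x) = 0 := hx
  rw [f_comm_apply] at hx
  obtain ⟨z, hz⟩ := exists_of_π_eq_zero φ _ _ hx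
  obtain ⟨y, z, hyz⟩ := h n x ⟨z, hz.symm⟩
  refine ⟨((cokernel.π φ).f (n + 1)).hom (-y), ?_⟩
  change ((cokernel φ).d (n + 1) n).hom _ = _
  have hφ : ((cokernel.π φ).f n).hom ((φ.f n).hom z) = 0 :=
    LinearMap.congr_fun (congrArg (fun g => (g.f n).hom) (cokernel.condition φ)) z
  rw [f_comm_apply, map_neg, eq_sub_of_add_eq hyz, map_sub, hφ, zero_sub]
  exact map_neg ((cokernel.π φ).f n).hom _

end Module

/-! ### Excision for relative complexes -/

section Excision

instance : rationalSingularChains.{u}.PreservesMonomorphisms :=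
  have : HasPullbacks (ModuleCat.{u} ℚ) := Abelian.hasPullbacks
  inferInstanceAs (((singularChainComplexFunctor (ModuleCat.{u} ℚ)).obj
    (ModuleCat.of ℚ (ULift.{u} ℚ))).PreservesMonomorphisms)

/-- Excision for singular homology. -/
theorem quasiIso_excision {P A W X : TopCat.{u}} (p : P ⟶ A) (q : P ⟶ W) (a : A ⟶ X) (w : W ⟶ X)
    (hcomm : q ≫ w = p ≫ a) (hq : Topology.IsEmbedding q)
    (ha : Topology.IsOpenEmbedding a) (hw : Topology.IsOpenEmbedding w)
    (hcov : Set.range a ∪ Set.range w = Set.univ) (hP : ∀ x y, a x = w y → ∃ z, q z = y) :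
    QuasiIso (cokernel.map (rationalSingularChains.map q) (rationalSingularChains.map a)
      (rationalSingularChains.map p) (rationalSingularChains.map w)
      (by rw [← Functor.map_comp, ← Functor.map_comp, hcomm])) := by
  set φ := cokernel.map (rationalSingularChains.map q) (rationalSingularChains.map a)
      (rationalSingularChains.map p) (rationalSingularChains.map w)
      (by rw [← Functor.map_comp, ← Functor.map_comp, hcomm]) with hφ
  have hπ (n : ℕ) (c : (rationalSingularChains.obj W).X n) :
      (φ.f n).hom (((cokernel.π (rationalSingularChains.map q)).f n).hom c) =
      ((cokernel.π (rationalSingularChains.map a)).f n).hom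
        (((rationalSingularChains.map w).f n).hom c) :=
    LinearMap.congr_fun (congrArg (fun g => (g.f n).hom)
      (cokernel.π_desc _ (rationalSingularChains.map w ≫ cokernel.π (rationalSingularChains.map a))
        _)) c
  have hcond {A' X' : TopCat.{u}} (a' : A' ⟶ X') (n : ℕ) (c) :
      ((cokernel.π (rationalSingularChains.map a')).f n).hom
        (((rationalSingularChains.map a').f n).hom c) = 0 :=
    LinearMap.congr_fun (congrArg (fun g => (g.f n).hom)
      (cokernel.condition (rationalSingularChains.map a'))) c
  refine quasiIso_of_injective φ (fun n => ?_) fun n x hx => ?_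
  · rw [injective_iff_map_eq_zero]
    intro x hx
    obtain ⟨c, rfl⟩ := π_surjective _ n x
    rw [hπ] at hx
    obtain ⟨c', hc'⟩ := exists_of_π_eq_zero _ n _ hx
    obtain ⟨z, rfl⟩ := SingChain.exists_lift_of_map_eq q a w hq hw.isEmbedding hP n c c' hc'.symm
    exact hcond _ _ _
  · obtain ⟨c, rfl⟩ := π_surjective _ n x
    obtain ⟨z, hz⟩ := hx
    obtain ⟨z, rfl⟩ := π_surjective _ _ z
    rw [hπ, f_comm_apply, ← sub_eq_zero, ← map_sub] at hz
    obtain ⟨y, hy⟩ := exists_of_π_eq_zero _ _ _ hz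
    obtain ⟨e, y, z, h⟩ := SingChain.exists_add_d_eq a w ha hw hcov n c
      ⟨y, z, by rw [hy, sub_add_cancel]⟩
    refine ⟨((cokernel.π (rationalSingularChains.map a)).f (n + 1)).hom e,
      ((cokernel.π (rationalSingularChains.map q)).f n).hom z, ?_⟩
    rw [hπ, f_comm_apply, ← map_add, h, map_add, hcond, zero_add]

end Excision

end RelHomology

/-! ### Local homology of a product with an interval -/

namespace RelHomology

open Limits

lemma quasiIso_of_homotopyEquiv {X Y : TopCat.{u}} (f : X ⟶ Y) (g : Y ⟶ X)
    (hfg : TopCat.Homotopy (f ≫ g) (𝟙 X)) (hgf : TopCat.Homotopy (g ≫ f) (𝟙 Y)) :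
    QuasiIso (rationalSingularChains.map f) := by
  refine ⟨fun i => (quasiIsoAt_iff_isIso_homologyMap _ _).2
    ⟨HomologicalComplex.homologyMap (rationalSingularChains.map g) i, ?_, ?_⟩⟩
  · have h := hfg.congr_homologyMap_singularChainComplexFunctor (ModuleCat.of ℚ (ULift.{u} ℚ)) i
    change HomologicalComplex.homologyMap (rationalSingularChains.map _) i =
      HomologicalComplex.homologyMap (rationalSingularChains.map _) i at h
    rwa [Functor.map_comp, HomologicalComplex.homologyMap_comp, CategoryTheory.Functor.map_id,
      HomologicalComplex.homologyMap_id] at h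
  · have h := hgf.congr_homologyMap_singularChainComplexFunctor (ModuleCat.of ℚ (ULift.{u} ℚ)) i
    change HomologicalComplex.homologyMap (rationalSingularChains.map _) i =
      HomologicalComplex.homologyMap (rationalSingularChains.map _) i at h
    rwa [Functor.map_comp, HomologicalComplex.homologyMap_comp, CategoryTheory.Functor.map_id,
      HomologicalComplex.homologyMap_id] at h

/-- The point dividing the segment from `t` to `s` in the ratio given by `r`. -/
def segment (s : Set.Ioo (0 : ℝ) 1) (r : unitInterval) (t : Set.Ioo (0 : ℝ) 1) :
    Set.Ioo (0 : ℝ) 1 :=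
  ⟨(1 - r) * t + r * s, (convex_Ioo (0 : ℝ) 1) t.2 s.2 (sub_nonneg.2 r.2.2) r.2.1 (by simp)⟩

lemma continuous_segment (s : Set.Ioo (0 : ℝ) 1) :
    Continuous fun x : unitInterval × Set.Ioo (0 : ℝ) 1 => segment s x.1 x.2 := by
  unfold segment
  fun_prop

lemma segment_zero (s t : Set.Ioo (0 : ℝ) 1) : segment s 0 t = t := by
  ext; simp [segment]

lemma segment_one (s t : Set.Ioo (0 : ℝ) 1) : segment s 1 t = s := by
  ext; simp [segment]

/-- A subspace of `(0,1) × B` that is star-shaped in the interval direction is homotopy equivalent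
to its projection. -/
lemma quasiIso_of_starShaped {B : Type u} [TopologicalSpace B] {T B' : TopCat.{u}}
    (j : T → Set.Ioo (0 : ℝ) 1 × B) (hj : Topology.IsEmbedding j)
    (i : B' → B) (hi : Topology.IsEmbedding i) (π : T ⟶ B') (hπ : ∀ x, i (π x) = (j x).2)
    (s : Set.Ioo (0 : ℝ) 1) (hs : ∀ b, ∃ x, j x = (s, i b))
    (hstar : ∀ (r : unitInterval) x, ∃ y, j y = (segment s r (j x).1, (j x).2)) :
    QuasiIso (rationalSingularChains.map π) := by
  choose σ hσ using hs
  choose H hH using hstar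
  have hσc : Continuous σ := by
    rw [hj.continuous_iff]
    have : j ∘ σ = fun b => (s, i b) := funext hσ
    rw [this]
    exact continuous_const.prodMk hi.continuous
  have hHc : Continuous fun x : unitInterval × T => H x.1 x.2 := by
    rw [hj.continuous_iff]
    have : (j ∘ fun x : unitInterval × T => H x.1 x.2) =
        fun x => (segment s x.1 (j x.2).1, (j x.2).2) := funext fun x => hH _ _
    rw [this]
    have hj2 : Continuous fun x : unitInterval × T => j x.2 := hj.continuous.comp continuous_snd
    exact ((continuous_segment s).comp (continuous_fst.prodMk hj2.fst)).prodMk hj2.snd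
  let g : B' ⟶ T := TopCat.ofHom ⟨σ, hσc⟩
  have h1 : g ≫ π = 𝟙 B' := by
    ext b
    apply hi.injective
    exact (hπ _).trans (congrArg Prod.snd (hσ b))
  -- The section at height `s` is a strict right inverse of the projection. Sliding along segments
  -- runs from the identity to section after projection, hence the reversal.
  refine quasiIso_of_homotopyEquiv π g (ContinuousMap.Homotopy.symm
    { toFun := fun x => H x.1 x.2
      continuous_toFun := hHc
      map_zero_left := fun x => ?_
      map_one_left := fun x => ?_ }) (h1 ▸ ContinuousMap.Homotopy.refl _)
  · apply hj.injective
    rw [hH, segment_zero]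
    rfl
  · apply hj.injective
    rw [hH, segment_one]
    refine Eq.trans ?_ (hσ (π x)).symm
    rw [hπ]

/-! ### The degree shift for the punctured product -/

section Product

variable (B : Type u) (b : B)

/-- The middle point of the open unit interval. -/
def half : Set.Ioo (0 : ℝ) 1 := ⟨1 / 2, by norm_num, by norm_num⟩

/-- The inclusion of a subspace. -/
def incl {X : Type u} [TopologicalSpace X] (A : Set X) : TopCat.of A ⟶ TopCat.of X :=
  TopCat.ofHom ⟨Subtype.val, continuous_subtype_val⟩

instance {X : Type u} [TopologicalSpace X] (A : Set X) : Mono (incl A) :=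
  (TopCat.mono_iff_injective _).2 Subtype.val_injective

/-- The punctured product. -/
abbrev Punctured : Type u := ({(half, b)}ᶜ : Set (Set.Ioo (0 : ℝ) 1 × B))

/-- The part of the punctured product that lies off the fibre or above the puncture. -/
def upper : Set (Punctured B b) := {x | half < x.1.1 ∨ x.1.2 ≠ b}

/-- The part of the punctured product that lies off the fibre or below the puncture. -/
def lower : Set (Punctured B b) := {x | x.1.1 < half ∨ x.1.2 ≠ b}

/-- The intersection of the two parts of the punctured product. -/
abbrev middle : Set (Punctured B b) := upper B b ∩ lower B b

variable {B b}

lemma mem_middle {x : Punctured B b} : x ∈ middle B b ↔ x.1.2 ≠ b := by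
  constructor
  · rintro ⟨h1 | h1, h2 | h2⟩
    · exact absurd h1 h2.asymm
    all_goals assumption
  · exact fun h => ⟨Or.inr h, Or.inr h⟩

lemma upper_union_lower : upper B b ∪ lower B b = Set.univ := by
  refine Set.eq_univ_of_forall fun x => ?_
  by_cases h : x.1.2 = b
  · rcases lt_trichotomy x.1.1 half with h1 | h1 | h1
    · exact Or.inr (Or.inl h1)
    · exact absurd (Prod.ext h1 h) x.2
    · exact Or.inl (Or.inl h1)
  · exact Or.inl (Or.inr h)

variable [TopologicalSpace B]

lemma continuous_fst_punctured : Continuous fun x : Punctured B b => x.1.1 :=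
  continuous_fst.comp continuous_subtype_val

lemma continuous_snd_punctured : Continuous fun x : Punctured B b => x.1.2 :=
  continuous_snd.comp continuous_subtype_val

lemma isOpen_upper [T1Space B] : IsOpen (upper B b) :=
  (isOpen_lt continuous_const continuous_fst_punctured).union
    (isOpen_compl_singleton.preimage continuous_snd_punctured)

lemma isOpen_lower [T1Space B] : IsOpen (lower B b) :=
  (isOpen_lt continuous_fst_punctured continuous_const).union
    (isOpen_compl_singleton.preimage continuous_snd_punctured)

lemma lt_segment {s t c : Set.Ioo (0 : ℝ) 1} (r : unitInterval) (hs : c < s) (ht : c < t) :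
    c < segment s r t :=
  (convex_Ioi (c : ℝ)) (Set.mem_Ioi.2 ht) (Set.mem_Ioi.2 hs) (sub_nonneg.2 r.2.2) r.2.1 (by simp)

lemma segment_lt {s t c : Set.Ioo (0 : ℝ) 1} (r : unitInterval) (hs : s < c) (ht : t < c) :
    segment s r t < c :=
  (convex_Iio (c : ℝ)) (Set.mem_Iio.2 ht) (Set.mem_Iio.2 hs) (sub_nonneg.2 r.2.2) r.2.1 (by simp)

/-- The projection of a subspace of the punctured product. -/
def projPart (A : Set (Punctured B b)) : TopCat.of A ⟶ TopCat.of B :=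
  TopCat.ofHom ⟨fun x => x.1.1.2, continuous_snd_punctured.comp continuous_subtype_val⟩

lemma isEmbedding_val_val (A : Set (Punctured B b)) :
    Topology.IsEmbedding fun x : A => (x.1.1 : Set.Ioo (0 : ℝ) 1 × B) :=
  Topology.IsEmbedding.subtypeVal.comp Topology.IsEmbedding.subtypeVal

lemma quasiIso_projPart {A : Set (Punctured B b)} (s : Set.Ioo (0 : ℝ) 1)
    (hs : ∀ b', ∃ h, (⟨(s, b'), h⟩ : Punctured B b) ∈ A)
    (hA : ∀ r, ∀ x ∈ A, ∃ h, (⟨(segment s r x.1.1, x.1.2), h⟩ : Punctured B b) ∈ A) :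
    QuasiIso (rationalSingularChains.map (projPart A)) := by
  refine quasiIso_of_starShaped (T := TopCat.of A) (fun x => x.1.1) (isEmbedding_val_val A)
    (B' := TopCat.of B) id Topology.IsEmbedding.id (projPart A) (fun x => rfl) s (fun b' => ?_)
    fun r x => ?_
  · obtain ⟨h, h'⟩ := hs b'
    exact ⟨⟨_, h'⟩, rfl⟩
  · obtain ⟨h, h'⟩ := hA r x.1 x.2
    exact ⟨⟨_, h'⟩, rfl⟩

lemma quasiIso_projPart_upper : QuasiIso (rationalSingularChains.map (projPart (upper B b))) := by
  have h34 : half < (⟨3 / 4, by norm_num, by norm_num⟩ : Set.Ioo (0 : ℝ) 1) :=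
    Subtype.mk_lt_mk.2 (by norm_num)
  refine quasiIso_projPart ⟨3 / 4, by norm_num, by norm_num⟩
    (fun b' => ⟨fun h => h34.ne' (congrArg Prod.fst h), Or.inl h34⟩) fun r x hx => ?_
  rcases hx with hx | hx
  · have := lt_segment r h34 hx
    exact ⟨fun h => this.ne' (congrArg Prod.fst h), Or.inl this⟩
  · exact ⟨fun h => hx (congrArg Prod.snd h), Or.inr hx⟩

lemma quasiIso_projPart_lower : QuasiIso (rationalSingularChains.map (projPart (lower B b))) := by
  have h14 : (⟨1 / 4, by norm_num, by norm_num⟩ : Set.Ioo (0 : ℝ) 1) < half :=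
    Subtype.mk_lt_mk.2 (by norm_num)
  refine quasiIso_projPart ⟨1 / 4, by norm_num, by norm_num⟩
    (fun b' => ⟨fun h => h14.ne (congrArg Prod.fst h), Or.inl h14⟩) fun r x hx => ?_
  rcases hx with hx | hx
  · have := segment_lt r h14 hx
    exact ⟨fun h => this.ne (congrArg Prod.fst h), Or.inl this⟩
  · exact ⟨fun h => hx (congrArg Prod.snd h), Or.inr hx⟩

/-- The projection of the part of the product off a fibre. -/
def projMiddle : TopCat.of (middle B b) ⟶ TopCat.of ({b}ᶜ : Set B) :=
  TopCat.ofHom ⟨fun x => ⟨x.1.1.2, mem_middle.1 x.2⟩,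
    (continuous_snd_punctured.comp continuous_subtype_val).subtype_mk _⟩

lemma quasiIso_projMiddle : QuasiIso (rationalSingularChains.map (projMiddle (B := B) (b := b))) := by
  refine quasiIso_of_starShaped (T := TopCat.of (middle B b)) (fun x => x.1.1)
    (isEmbedding_val_val _) (B' := TopCat.of ({b}ᶜ : Set B)) Subtype.val
    Topology.IsEmbedding.subtypeVal projMiddle (fun x => rfl) half (fun b' => ?_) fun r x => ?_
  · exact ⟨⟨⟨(half, b'.1), fun h => b'.2 (congrArg Prod.snd h :)⟩, mem_middle.2 b'.2⟩, rfl⟩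
  · exact ⟨⟨⟨(segment half r x.1.1.1, x.1.1.2), fun h => mem_middle.1 x.2 (congrArg Prod.snd h)⟩,
      mem_middle.2 (mem_middle.1 x.2 :)⟩, rfl⟩

/-- Two out of three: `upper` and the full product both project to `B` by quasi-isomorphisms. -/
lemma quasiIso_upper : QuasiIso (rationalSingularChains.map (incl (upper B b)) ≫
    rationalSingularChains.map (incl ({(half, b)}ᶜ : Set (Set.Ioo (0 : ℝ) 1 × B)))) := by
  let π : TopCat.of (Set.Ioo (0 : ℝ) 1 × B) ⟶ TopCat.of B := TopCat.ofHom ⟨Prod.snd, continuous_snd⟩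
  have hπ : QuasiIso (rationalSingularChains.map π) :=
    quasiIso_of_starShaped (T := TopCat.of (Set.Ioo (0 : ℝ) 1 × B)) id Topology.IsEmbedding.id
      (B' := TopCat.of B) id Topology.IsEmbedding.id π (fun x => rfl) half
      (fun b' => ⟨_, rfl⟩) fun r x => ⟨_, rfl⟩
  have h := quasiIso_projPart_upper (B := B) (b := b)
  have e : projPart (upper B b) = (incl (upper B b) ≫ incl _) ≫ π := rfl
  rw [e, Functor.map_comp, Functor.map_comp] at h
  exact quasiIso_of_comp_right _ (rationalSingularChains.map π)

/-- The local homology of a product with an open interval. -/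
lemma nonempty_localHomology_product_iso [T1Space B] (b : B) (k : ℕ) :
    Nonempty (relativeRationalHomology (Set.Ioo (0 : ℝ) 1 × B) {(half, b)}ᶜ (k + 1) ≅
      relativeRationalHomology B {b}ᶜ k) := by
  let q : TopCat.of (middle B b) ⟶ TopCat.of (lower B b) :=
    TopCat.ofHom ⟨Set.inclusion Set.inter_subset_right, continuous_inclusion _⟩
  let p : TopCat.of (middle B b) ⟶ TopCat.of (upper B b) :=
    TopCat.ofHom ⟨Set.inclusion Set.inter_subset_left, continuous_inclusion _⟩
  have hq : Topology.IsEmbedding q := Topology.IsEmbedding.inclusion Set.inter_subset_right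
  have : Mono q := (TopCat.mono_iff_injective _).2 hq.injective
  have h1 := quasiIso_excision p q (incl (upper B b)) (incl (lower B b)) rfl hq
    isOpen_upper.isOpenEmbedding_subtypeVal isOpen_lower.isOpenEmbedding_subtypeVal
    (by
      refine Eq.trans ?_ (upper_union_lower (B := B) (b := b))
      exact congrArg₂ _ Subtype.range_val Subtype.range_val)
    (fun x y hxy => ⟨⟨y.1, by
      have : x.1 = y.1 := hxy
      exact ⟨this ▸ x.2, y.2⟩⟩, rfl⟩)
  have h2 := quasiIso_cokernel_map (rationalSingularChains.map q)
    (rationalSingularChains.map (incl ({b}ᶜ : Set B)))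
    (rationalSingularChains.map projMiddle) (rationalSingularChains.map (projPart (lower B b)))
    (by rw [← Functor.map_comp, ← Functor.map_comp]; rfl)
    quasiIso_projMiddle quasiIso_projPart_lower
  -- The degree drops here, through the connecting map of the triple (product, punctured product,
  -- `upper`).
  have e1 := homologyIsoOfQuasiIsoComp _ _ (quasiIso_upper (B := B) (b := b)) (k + 1) k rfl
  exact ⟨e1 ≪≫ (homologyIsoOfQuasiIso h1 k).symm ≪≫ homologyIsoOfQuasiIso h2 k⟩

end Product

/-- Local homology may be computed in an open neighbourhood. -/
lemma nonempty_localHomology_iso {X Y : Type u} [TopologicalSpace X] [TopologicalSpace Y]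
    [T1Space X] (f : Y → X) (hf : Topology.IsOpenEmbedding f) (y : Y) (k : ℕ) :
    Nonempty (relativeRationalHomology Y {y}ᶜ k ≅ relativeRationalHomology X {f y}ᶜ k) := by
  let w : TopCat.of Y ⟶ TopCat.of X := TopCat.ofHom ⟨f, hf.continuous⟩
  let p : TopCat.of ({y}ᶜ : Set Y) ⟶ TopCat.of ({f y}ᶜ : Set X) :=
    TopCat.ofHom ⟨fun z => ⟨f z, fun h => z.2 (hf.injective h)⟩,
      (hf.continuous.comp continuous_subtype_val).subtype_mk _⟩
  have h := quasiIso_excision p (incl ({y}ᶜ : Set Y)) (incl ({f y}ᶜ : Set X)) w rfl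
    Topology.IsEmbedding.subtypeVal isOpen_compl_singleton.isOpenEmbedding_subtypeVal hf
    (by
      refine Set.eq_univ_of_forall fun x => ?_
      by_cases hx : x = f y
      · exact Or.inr ⟨y, hx.symm⟩
      · exact Or.inl ⟨⟨x, hx⟩, rfl⟩)
    (fun x z hxz => ⟨⟨z, by
      rintro rfl
      exact x.2 hxz⟩, rfl⟩)
  exact ⟨homologyIsoOfQuasiIso h k⟩

end RelHomology

/-! ### The boundary of a rational homology manifold -/

/-- Closed points are the only separation that the excision arguments need; they make the complement
of a point open. -/
lemma IsTopologicallyStratified.t1Space {m : ℤ} {X : Type u} [TopologicalSpace X] {F : ℤ → Set X}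
    (h : IsTopologicallyStratified m X F) : T1Space X := by
  rw [IsTopologicallyStratified] at h
  rcases h.2 with ⟨-, h⟩ | ⟨-, -, h⟩ | ⟨-, -, h, -⟩
  · exact ⟨fun x => h.elim x⟩
  all_goals infer_instance

lemma IsStratifiedPseudomanifoldWithBoundary.exists_isOpenEmbedding {n : ℤ} {X : Type u}
    [TopologicalSpace X] {B : Set X} {F : ℤ → Set X}
    (h : IsStratifiedPseudomanifoldWithBoundary n B F) :
    ∃ f : Set.Ioo (0 : ℝ) 1 × B → ↥(Bᶜ), Topology.IsOpenEmbedding f := by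
  obtain ⟨N, hN, hBN, φ, -, hφ⟩ := h.collar
  let i : Set.Ioo (0 : ℝ) 1 → Set.Ico (0 : ℝ) 1 := Set.inclusion Set.Ioo_subset_Ico_self
  have hi : Topology.IsOpenEmbedding i := by
    refine ⟨Topology.IsEmbedding.inclusion _, ?_⟩
    have : Set.range i = {t : Set.Ico (0 : ℝ) 1 | (0 : ℝ) < t} := by
      refine (Set.range_inclusion _).trans (Set.ext fun t => ?_)
      exact ⟨fun h => h.1, fun h => ⟨h, t.2.2⟩⟩
    rw [this]
    exact isOpen_lt continuous_const continuous_subtype_val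
  let g : Set.Ioo (0 : ℝ) 1 × B → X := fun x => (φ.symm (i x.1, x.2) : X)
  have hg : Topology.IsOpenEmbedding g := hN.isOpenEmbedding_subtypeVal.comp
    (φ.symm.isOpenEmbedding.comp (hi.prodMap Topology.IsOpenEmbedding.id))
  -- The collar sends points of `B` to level `0`, whereas `g x` sits at a positive level.
  have hgB : ∀ x, g x ∈ Bᶜ := by
    intro x hx
    have h1 := hφ ⟨g x, hx⟩
    have h2 : φ ⟨g x, hBN hx⟩ = (i x.1, x.2) := φ.apply_symm_apply _
    have h3 : (i x.1 : ℝ) = 0 := congrArg (fun z => (z.1 : ℝ)) (h2.symm.trans h1)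
    exact x.1.2.1.ne' h3
  exact ⟨fun x => ⟨g x, hgB x⟩,
    Topology.IsOpenEmbedding.of_comp _ h.isClosed.isOpen_compl.isOpenEmbedding_subtypeVal hg⟩

end

theorem mainTheorem12 (n : ℕ) (X : Type u) [TopologicalSpace X] (B : Set X)
    (h : IsRationalHomologyManifoldWithBoundary (n : ℤ) X B) :
    IsRationalHomologyManifold ((n : ℤ) - 1) ↥B := by
  obtain ⟨⟨F, hF⟩, hX⟩ := h
  have : T1Space B := hF.boundary.stratified.t1Space
  have : T1Space ↥(Bᶜ) := hF.interior.stratified.t1Space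
  obtain ⟨f, hf⟩ := hF.exists_isOpenEmbedding
  have key (b : B) (k : ℕ) : Nonempty (relativeRationalHomology ↥(Bᶜ)
      {f (RelHomology.half, b)}ᶜ (k + 1) ≃ₗ[ℚ] relativeRationalHomology B {b}ᶜ k) := by
    obtain ⟨e⟩ := RelHomology.nonempty_localHomology_iso f hf (RelHomology.half, b) (k + 1)
    obtain ⟨e'⟩ := RelHomology.nonempty_localHomology_product_iso b k
    exact ⟨(e.symm ≪≫ e').toLinearEquiv⟩
  -- Degree `k` on `B` corresponds to degree `k + 1` in the interior, and `k = n - 1` exactly when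
  -- `k + 1 = n`; this covers `n = 0` without a separate case.
  refine ⟨⟨_, hF.boundary⟩, fun b k hk => ?_, fun b k hk => ?_⟩
  · obtain ⟨e⟩ := key b k
    obtain ⟨e'⟩ := hX.localHomology_eq (f (RelHomology.half, b)) (k + 1) (by push_cast; omega)
    exact ⟨e.symm.trans e'⟩
  · obtain ⟨e⟩ := key b k
    have := hX.localHomology_ne (f (RelHomology.half, b)) (k + 1) (by push_cast; omega)
    exact e.symm.toEquiv.subsingleton
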